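/- Let $r,c\ge 1$ and let $A_1,\dots,A_c$ be undirected simple graphs on the vertex set $[r]$ with edge weights in $\{\pm1\}$ (atoms), such that the adjacency matrix of every $A_j$ has exactly the two distinct eigenvalues $\lambda_1\ne\lambda_2$ (the same pair for every $j$). For each $n$, let $\mathcal I_n$ be a random additive $n$-lift of $(A_1,\dots,A_c)$ with $1$-wise uniform negations, defined as follows. Its vertex set is $V_n=[r]\times[n]$. Choose independent uniformly random permutations $\sigma_{ij}$ of $[n]$, $(i,j)\in[r]\times[c]$ (a random $n$-lift of the complete bipartite graph $K_{r,c}$); the constraint vertices are the pairs $f=(j,b)\in[c]\times[n]$, and $f=(j,b)$ is joined to those $(i,a)\in V_n$ with $\sigma_{ij}(a)=b$. Independently of the lift, choose signs $\xi^{(f)}_i\in\{\pm1\}$, $i\in[r]$, such that each $\xi^{(f)}_i$ is uniform on $\{\pm1\}$, the signs with the same $f$ may be arbitrarily correlated, and the vectors $(\xi^{(f)}_i)_{i\in[r]}$ are independent for different $f$. The adjacency matrix $A_{\mathcal I_n}$ has the entries $$A_{\mathcal I_n}[(i,a),(i',a')]=\sum_{\substack{f=(j,b)\\ \sigma_{ij}(a)=b=\sigma_{i'j}(a')}}\xi^{(f)}_i\,\xi^{(f)}_{i'}\,A_j[i,i'].$$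 Then for every $\varepsilon>0$, with probability $1-o(1)$ as $n\to\infty$, there are real positive semidefinite $V_n\times V_n$ matrices $M_+$ and $M_-$ with all-ones diagonals such that $$\langle A_{\mathcal I_n},M_+\rangle\ \ge\ \bigl(\lambda_1+\lambda_2+2\sqrt{(c-1)(-\lambda_1\lambda_2)}-\varepsilon\bigr)\,|V_n|,$$ $$\langle A_{\mathcal I_n},M_-\rangle\ \le\ \bigl(\lambda_1+\lambda_2-2\sqrt{(c-1)(-\lambda_1\lambda_2)}+\varepsilon\bigr)\,|V_n|,$$ where $\langle A,M\rangle=\sum_{u,v}A_{uv}M_{uv}$ and $|V_n|=rn$. -/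

import Mathlib

open MeasureTheory ProbabilityTheory

/-- An atom on the vertex set `[r]`: an undirected simple graph with edge weights `±1`, given by its
adjacency matrix (the entry `0` means that there is no edge). -/
structure Atom (r : ℕ) where
  adj : Matrix (Fin r) (Fin r) ℝ
  symm : adj.IsSymm
  loopless : ∀ i, adj i i = 0
  weight : ∀ i j, adj i j = 0 ∨ adj i j = 1 ∨ adj i j = -1

/-- The variable vertices of an `n`-fold lift of `K_{r,c}`: `r` groups of size `n`. -/
abbrev VarVertex (r n : ℕ) : Type := Fin r × Fin n

/-- The constraint vertices of an `n`-fold lift of `K_{r,c}`: `c` groups of size `n`. -/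
abbrev ConVertex (c n : ℕ) : Type := Fin c × Fin n

/-- An `r`-ary, `c`-atom constraint graph: an `n`-fold lift of the complete bipartite graph
`K_{r,c}`, given by one permutation of `[n]` for every edge `(i, j)` of `K_{r,c}`. -/
def ConstraintGraph (r c n : ℕ) : Type := Fin r → Fin c → Equiv.Perm (Fin n)

namespace ConstraintGraph

instance (r c n : ℕ) : Fintype (ConstraintGraph r c n) :=
  inferInstanceAs (Fintype (Fin r → Fin c → Equiv.Perm (Fin n)))

instance (r c n : ℕ) : MeasurableSpace (ConstraintGraph r c n) := ⊤

/-- Adjacency in the constraint graph: the variable vertex `(i, a)` is joined to the constraint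
vertex `(j, b)` if and only if the permutation on the edge `(i, j)` maps `a` to `b`. -/
def Incident {r c n : ℕ} (K : ConstraintGraph r c n) (v : VarVertex r n) (f : ConVertex c n) :
    Prop :=
  K v.1 f.1 v.2 = f.2

instance {r c n : ℕ} (K : ConstraintGraph r c n) (v : VarVertex r n) (f : ConVertex c n) :
    Decidable (K.Incident v f) :=
  inferInstanceAs (Decidable (K v.1 f.1 v.2 = f.2))

/-- The adjacency matrix of the instance graph with negations: every constraint vertex `f` of
group `j` places a copy of the atom `A j` on its neighbours, the edge `{i, i'}` having its weight
multiplied by `ξ f i * ξ f i'`.  The weights of parallel edges are added. -/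
def instanceAdj {r c n : ℕ} (K : ConstraintGraph r c n) (A : Fin c → Atom r)
    (ξ : ConVertex c n → Fin r → ℤˣ) : Matrix (VarVertex r n) (VarVertex r n) ℝ :=
  fun v w => ∑ f : ConVertex c n,
    if K.Incident v f ∧ K.Incident w f then
      (((ξ f v.1 * ξ f w.1 : ℤˣ) : ℤ) : ℝ) * (A f.1).adj v.1 w.1
    else 0

end ConstraintGraph

/-- `K` and `ξ` are the constraint graph and the signs of a random additive `n`-lift with `1`-wise
uniform negations: `K` is a uniformly random `n`-lift of `K_{r,c}` (independent uniform
permutations on the edges), each single sign `ξ f i` is uniform on `{±1}` (with arbitrary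
correlations for a fixed `f`), the sign vectors of different constraint vertices are independent,
and the signs are independent of the lift. -/
structure IsRandomNegatedLift {Ω : Type*} [MeasurableSpace Ω] (μ : Measure Ω) {r c n : ℕ}
    (K : Ω → ConstraintGraph r c n) (ξ : Ω → ConVertex c n → Fin r → ℤˣ) : Prop where
  measurable_lift : Measurable K
  measurable_sign : Measurable ξ
  lift_uniform : μ.map K = uniformOn Set.univ
  sign_uniform : ∀ f i s, μ {ω | ξ ω f i = s} = 1 / 2
  sign_indep : iIndepFun (fun f ω => ξ ω f) μ
  lift_indep_sign : IndepFun K ξ μ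

/-- `M` is positive semidefinite with all-ones diagonal. -/
def IsSDPFeasible {V : Type*} [Fintype V] (M : Matrix V V ℝ) : Prop :=
  M.PosSemidef ∧ ∀ v, M v v = 1

/-- The entrywise inner product `⟨A, M⟩` of real matrices. -/
def matInner {V : Type*} [Fintype V] (A M : Matrix V V ℝ) : ℝ :=
  ∑ u, ∑ v, A u v * M u v

/-! Put `s = l₁ + l₂`, `d = -(l₁ * l₂)`. The adjacency matrix of the instance graph is the sum,
over the constraint vertices `f`, of signed copies `B f` of the atoms, and
`B f ^ 2 = s • B f + d • E f` where `E f` is the signed copy of the identity, so that the `E f` add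
up to `c • 1`. Hence the sums of the products `B f₀ * ⋯ * B fₖ` with `fₜ ≠ fₜ₊₁` satisfy the
three-term recurrence with Jacobi coefficients `0, s, s, …` and `d * c, d * (c - 1), d * (c - 1),
…`. At a vertex through which no short cycle passes these products have vanishing diagonal entry,
whatever the signs are, so up to a high degree the spectral measure there is the one with these
Jacobi coefficients: it is the spectral measure of the infinite additive lift, with edges `s ± 2 *
√((c - 1) * d)`. Spreading the mass evenly over many orthogonal polynomials gives a polynomial `q`
for which `q ^ 2` integrates to `1` and `X * q ^ 2` integrates to nearly an edge.

The matrix `q(A) ^ 2` is positive semidefinite, has the diagonal entry `1` at those vertices, and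
its inner product with `A` has the right contribution from them. The remaining vertices are made
isolated, at a cost bounded by a constant times their number. For random permutations this number
is `o(n)` with probability `1 - o(1)`: redirecting the closing step of a walk along a reduced word
to an arbitrary unvisited point shows that the walk closes up with probability `O(1 / n)`. -/

section Jacobi

open Polynomial Finset

variable {R : Type*} [CommRing R]

/-- The monic orthogonal polynomials with Jacobi coefficients `α` and `β`, given by their three-term
recurrence.  The index of `β` is shifted: `β k` couples the polynomials `k` and `k + 1`. -/
noncomputable def jacobiPoly (α β : ℕ → R) : ℕ → R[X]
  | 0 => 1
  | 1 => X - C (α 0)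
  | k + 2 => (X - C (α (k + 1))) * jacobiPoly α β (k + 1) - C (β k) * jacobiPoly α β k

/-- A linear functional that agrees, as far as the polynomials `jacobiPoly α β k` with `k ≤ N` can
tell, with integration against the spectral measure of the Jacobi matrix. -/
def IsJacobiFunctional (α β : ℕ → R) (N : ℕ) (φ : R[X] →ₗ[R] R) : Prop :=
  ∀ k ≤ N, φ (jacobiPoly α β k) = if k = 0 then 1 else 0

variable {α β : ℕ → R}

lemma X_mul_jacobiPoly_zero : X * jacobiPoly α β 0 = jacobiPoly α β 1 + α 0 • jacobiPoly α β 0 := by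
  simp [jacobiPoly, smul_eq_C_mul]

lemma X_mul_jacobiPoly_succ (k : ℕ) : X * jacobiPoly α β (k + 1) =
    jacobiPoly α β (k + 2) + α (k + 1) • jacobiPoly α β (k + 1) + β k • jacobiPoly α β k := by
  rw [jacobiPoly, smul_eq_C_mul, smul_eq_C_mul]
  ring

lemma jacobiPoly_one_mul_succ (l : ℕ) : jacobiPoly α β 1 * jacobiPoly α β (l + 1) =
    jacobiPoly α β (l + 2) + (α (l + 1) - α 0) • jacobiPoly α β (l + 1)
      + β l • jacobiPoly α β l := by
  have h := X_mul_jacobiPoly_succ (α := α) (β := β) l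
  simp only [smul_eq_C_mul, C_sub] at h ⊢
  rw [show jacobiPoly α β 1 = X - C (α 0) from rfl]
  linear_combination h

lemma jacobiPoly_add_two_mul_succ (k l : ℕ) :
    jacobiPoly α β (k + 2) * jacobiPoly α β (l + 1) =
      jacobiPoly α β (k + 1) * jacobiPoly α β (l + 2)
        + (α (l + 1) - α (k + 1)) • (jacobiPoly α β (k + 1) * jacobiPoly α β (l + 1))
        + β l • (jacobiPoly α β (k + 1) * jacobiPoly α β l)
        - β k • (jacobiPoly α β k * jacobiPoly α β (l + 1)) := by
  have hk := X_mul_jacobiPoly_succ (α := α) (β := β) k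
  have hl := X_mul_jacobiPoly_succ (α := α) (β := β) l
  simp only [smul_eq_C_mul, C_sub] at hk hl ⊢
  linear_combination jacobiPoly α β (k + 1) * hl - jacobiPoly α β (l + 1) * hk

namespace IsJacobiFunctional

variable {N : ℕ} {φ : R[X] →ₗ[R] R}

theorem apply_mul_of_lt (h : IsJacobiFunctional α β N φ) {k l : ℕ} (hkl : k < l)
    (hN : k + l ≤ N) : φ (jacobiPoly α β k * jacobiPoly α β l) = 0 := by
  induction k using Nat.strong_induction_on generalizing l with
  | _ k ih =>
    obtain ⟨l, rfl⟩ : ∃ m, l = m + 1 := ⟨l - 1, by omega⟩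
    match k with
    | 0 => simpa [jacobiPoly] using h (l + 1) (by omega)
    | 1 =>
      rw [jacobiPoly_one_mul_succ]
      simp [h (l + 2) (by omega), h (l + 1) (by omega), h l (by omega), show l ≠ 0 by omega]
    | k + 2 =>
      rw [jacobiPoly_add_two_mul_succ]
      simp only [map_add, map_sub, map_smul]
      simp [ih (k + 1) (by omega) (l := l + 2) (by omega) (by omega),
        ih (k + 1) (by omega) (l := l + 1) (by omega) (by omega),
        ih (k + 1) (by omega) (l := l) (by omega) (by omega),
        ih k (by omega) (l := l + 1) (by omega) (by omega)]

theorem apply_mul_self (h : IsJacobiFunctional α β N φ) {k : ℕ} (hN : 2 * k ≤ N) :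
    φ (jacobiPoly α β k * jacobiPoly α β k) = ∏ i ∈ range k, β i := by
  induction k with
  | zero => simpa [jacobiPoly] using h 0 (Nat.zero_le N)
  | succ k ih =>
    rw [prod_range_succ, ← ih (by omega)]
    match k with
    | 0 =>
      rw [jacobiPoly_one_mul_succ, map_add, map_add, map_smul, map_smul, h 2 (by omega),
        h 1 (by omega), h 0 (by omega), show jacobiPoly α β 0 = 1 from rfl, mul_one,
        show φ 1 = 1 by simpa [jacobiPoly] using h 0 (Nat.zero_le N)]
      simp
    | k + 1 =>
      rw [jacobiPoly_add_two_mul_succ]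
      simp only [map_add, map_sub, map_smul]
      simp [h.apply_mul_of_lt (show k + 1 < k + 3 by omega) (by omega),
        h.apply_mul_of_lt (show k + 1 < k + 2 by omega) (by omega),
        h.apply_mul_of_lt (show k < k + 2 by omega) (by omega), mul_comm]

theorem apply_X_mul_mul_self (h : IsJacobiFunctional α β N φ) {k : ℕ} (hN : 2 * k + 1 ≤ N) :
    φ (X * jacobiPoly α β k * jacobiPoly α β k) = α k * ∏ i ∈ range k, β i := by
  match k with
  | 0 =>
    rw [X_mul_jacobiPoly_zero, add_mul, smul_mul_assoc, map_add, map_smul,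
      h.apply_mul_self (by omega), mul_comm, h.apply_mul_of_lt one_pos (by omega), zero_add,
      smul_eq_mul]
  | k + 1 =>
    rw [X_mul_jacobiPoly_succ, add_mul, add_mul, smul_mul_assoc, smul_mul_assoc, map_add, map_add,
      map_smul, map_smul, h.apply_mul_self (by omega), mul_comm (jacobiPoly α β (k + 2)),
      h.apply_mul_of_lt (Nat.lt_succ_self _) (by omega),
      h.apply_mul_of_lt (Nat.lt_succ_self _) (by omega), smul_zero, add_zero, zero_add,
      smul_eq_mul]

theorem apply_mul_sum_of_le (h : IsJacobiFunctional α β N φ) (w : ℕ → R) {m L : ℕ} (hL : L ≤ m)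
    (hN : m + L ≤ N + 1) :
    φ (jacobiPoly α β m * ∑ k ∈ range L, w k • jacobiPoly α β k) = 0 := by
  rw [mul_sum, map_sum]
  refine sum_eq_zero fun k hk => ?_
  have hkL := mem_range.1 hk
  rw [mul_smul_comm, map_smul, mul_comm, h.apply_mul_of_lt (by omega) (by omega), smul_zero]

theorem apply_mul_sum_succ (h : IsJacobiFunctional α β N φ) (w : ℕ → R) {m : ℕ}
    (hN : 2 * m ≤ N) :
    φ (jacobiPoly α β m * ∑ k ∈ range (m + 1), w k • jacobiPoly α β k) =
      w m * ∏ i ∈ range m, β i := by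
  rw [sum_range_succ, mul_add, map_add, h.apply_mul_sum_of_le w le_rfl (by omega), zero_add,
    mul_smul_comm, map_smul, h.apply_mul_self hN, smul_eq_mul]

theorem apply_X_mul_mul_sum (h : IsJacobiFunctional α β N φ) (w : ℕ → R) {m : ℕ}
    (hN : 2 * m + 2 ≤ N) :
    φ (X * jacobiPoly α β (m + 1) * ∑ k ∈ range (m + 1), w k • jacobiPoly α β k) =
      w m * ∏ i ∈ range (m + 1), β i := by
  rw [X_mul_jacobiPoly_succ, add_mul, add_mul, smul_mul_assoc, smul_mul_assoc, map_add, map_add,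
    map_smul, map_smul, h.apply_mul_sum_of_le w (by omega) (by omega),
    h.apply_mul_sum_of_le w le_rfl (by omega), h.apply_mul_sum_succ w (by omega), prod_range_succ,
    smul_zero, add_zero, zero_add, smul_eq_mul]
  ring

theorem apply_sum_mul_self (h : IsJacobiFunctional α β N φ) (w : ℕ → R) {L : ℕ}
    (hN : 2 * L ≤ N + 1) :
    φ ((∑ k ∈ range L, w k • jacobiPoly α β k) * ∑ k ∈ range L, w k • jacobiPoly α β k) =
      ∑ k ∈ range L, w k ^ 2 * ∏ i ∈ range k, β i := by
  induction L with
  | zero => simp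
  | succ L ih =>
    have hexpand (q p : R[X]) (a : R) :
        (q + a • p) * (q + a • p) = q * q + (2 * a) • (p * q) + a ^ 2 • (p * p) := by
      simp only [smul_eq_C_mul, C_mul, C_pow, map_ofNat]
      ring
    rw [sum_range_succ, hexpand, map_add, map_add, map_smul, map_smul, ih (by omega),
      h.apply_mul_sum_of_le w le_rfl (by omega), h.apply_mul_self (by omega), smul_zero, add_zero,
      smul_eq_mul, sum_range_succ]

/-- The right-hand side is the quadratic form of the Jacobi matrix. -/
theorem apply_X_mul_sum_mul_self (h : IsJacobiFunctional α β N φ) (w : ℕ → R) {L : ℕ}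
    (hN : 2 * L + 1 ≤ N) :
    φ (X * ((∑ k ∈ range (L + 1), w k • jacobiPoly α β k) *
        ∑ k ∈ range (L + 1), w k • jacobiPoly α β k)) =
      ∑ k ∈ range (L + 1), α k * (w k ^ 2 * ∏ i ∈ range k, β i)
        + 2 * ∑ k ∈ range L, w k * w (k + 1) * ∏ i ∈ range (k + 1), β i := by
  have hexpand (q p : R[X]) (a : R) : X * ((q + a • p) * (q + a • p)) =
      X * (q * q) + (2 * a) • (X * p * q) + a ^ 2 • (X * p * p) := by
    simp only [smul_eq_C_mul, C_mul, C_pow, map_ofNat]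
    ring
  induction L with
  | zero =>
    rw [sum_range_succ, hexpand, map_add, map_smul, h.apply_X_mul_mul_self (by omega)]
    simp
    ring
  | succ L ih =>
    rw [sum_range_succ (fun k => w k • jacobiPoly α β k), hexpand, map_add, map_add, map_smul,
      map_smul, ih (by omega), h.apply_X_mul_mul_sum w (by omega),
      h.apply_X_mul_mul_self (by omega), sum_range_succ _ (L + 1),
      sum_range_succ (fun k => w k * w (k + 1) * _), smul_eq_mul, smul_eq_mul]
    ring

end IsJacobiFunctional

end Jacobi

section TestPoly

open Polynomial Finset

/-- The sequence `x, y, y, …`.  Both Jacobi sequences of the spectral measure at a vertex of the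
infinite additive lift have this form: the root is special, all other levels look alike. -/
def rootThenBulk {R : Type*} (x y : R) : ℕ → R
  | 0 => x
  | _ + 1 => y

lemma rootThenBulk_zero {R : Type*} (x y : R) : rootThenBulk x y 0 = x := rfl

lemma rootThenBulk_succ {R : Type*} (x y : R) (k : ℕ) : rootThenBulk x y (k + 1) = y := rfl

lemma prod_range_succ_rootThenBulk {R : Type*} [CommMonoid R] (x y : R) (k : ℕ) :
    ∏ i ∈ range (k + 1), rootThenBulk x y i = x * y ^ k := by
  rw [prod_range_succ', mul_comm]
  simp [rootThenBulk_zero, rootThenBulk_succ]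

theorem exists_testPoly_of_length {s ρ b : ℝ} (hb : 0 < b) (L : ℕ) (hρ : ρ ≠ 0 ∨ L = 0) :
    ∃ q : ℝ[X], ∀ φ : ℝ[X] →ₗ[ℝ] ℝ,
      IsJacobiFunctional (rootThenBulk 0 s) (rootThenBulk b (ρ ^ 2)) (2 * L + 3) φ →
        φ (q * q) = 1 ∧ φ (X * (q * q)) = s + 2 * ρ * (L / (L + 1)) := by
  have hcancel (k : ℕ) (hk : k ≤ L) : ρ⁻¹ ^ k * ρ ^ k = 1 := by
    rcases hρ with hρ | rfl
    · rw [← mul_pow, inv_mul_cancel₀ hρ, one_pow]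
    · simp [Nat.le_zero.1 hk]
  -- All levels `1, …, L + 1` receive the same mass `1 / (L + 1)`.
  let w : ℕ → ℝ
    | 0 => 0
    | k + 1 => (√(b * (L + 1)))⁻¹ * ρ⁻¹ ^ k
  let h (k : ℕ) : ℝ := ∏ i ∈ range k, rootThenBulk b (ρ ^ 2) i
  have hscale : (√(b * (L + 1)))⁻¹ ^ 2 * b = 1 / (L + 1) := by
    rw [inv_pow, Real.sq_sqrt (by positivity)]
    field_simp
  have hdiag (k : ℕ) (hk : k < L + 1) : w (k + 1) ^ 2 * h (k + 1) = 1 / (L + 1) := by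
    have hk' := hcancel k (by omega)
    simp only [w, h, prod_range_succ_rootThenBulk]
    linear_combination (ρ⁻¹ ^ k * ρ ^ k) ^ 2 * hscale + 1 / (L + 1) * (ρ⁻¹ ^ k * ρ ^ k + 1) * hk'
  have hoff (k : ℕ) (hk : k < L) : w (k + 1) * w (k + 2) * h (k + 2) = ρ / (L + 1) := by
    have hk' := hcancel k (by omega)
    have hk'' := hcancel (k + 1) (by omega)
    simp only [w, h, prod_range_succ_rootThenBulk]
    linear_combination ρ * (ρ⁻¹ ^ k * ρ ^ k) * (ρ⁻¹ ^ (k + 1) * ρ ^ (k + 1)) * hscale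
      + ρ / (L + 1) * (ρ⁻¹ ^ k * ρ ^ k) * hk'' + ρ / (L + 1) * hk'
  have hmass : ∑ k ∈ range (L + 1), w (k + 1) ^ 2 * h (k + 1) = 1 := by
    rw [sum_congr rfl fun k hk => hdiag k (mem_range.1 hk)]
    simp
    field_simp
  have henergy : ∑ k ∈ range (L + 1), w k * w (k + 1) * h (k + 1) = L * (ρ / (L + 1)) := by
    rw [sum_range_succ', sum_congr rfl fun k hk => hoff k (mem_range.1 hk)]
    simp [w]
  refine ⟨∑ k ∈ range (L + 2), w k • jacobiPoly (rootThenBulk 0 s) (rootThenBulk b (ρ ^ 2)) k,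
    fun φ hφ => ⟨?_, ?_⟩⟩
  · rw [hφ.apply_sum_mul_self w (by omega), sum_range_succ', hmass]
    simp [w]
  · rw [hφ.apply_X_mul_sum_mul_self w (by omega), henergy, sum_range_succ']
    simp only [rootThenBulk_zero, rootThenBulk_succ, ← mul_sum]
    rw [hmass]
    ring

theorem exists_testPoly (s ρ : ℝ) {b ε : ℝ} (hb : 0 < b) (hε : 0 < ε) :
    ∃ (N : ℕ) (q : ℝ[X]) (τ : ℝ), |τ - (s + 2 * ρ)| ≤ ε ∧ ∀ φ : ℝ[X] →ₗ[ℝ] ℝ,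
      IsJacobiFunctional (rootThenBulk 0 s) (rootThenBulk b (ρ ^ 2)) N φ →
        φ (q * q) = 1 ∧ φ (X * (q * q)) = τ := by
  obtain ⟨L, hρL, hL⟩ : ∃ L : ℕ, (ρ ≠ 0 ∨ L = 0) ∧ 2 * |ρ| ≤ ε * (L + 1) := by
    by_cases hρ : ρ = 0
    · exact ⟨0, Or.inr rfl, by simp [hρ, hε.le]⟩
    · obtain ⟨L, hL⟩ := exists_nat_ge (2 * |ρ| / ε)
      refine ⟨L, Or.inl hρ, ?_⟩
      rw [div_le_iff₀ hε] at hL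
      linarith
  obtain ⟨q, hq⟩ := exists_testPoly_of_length (s := s) hb L hρL
  refine ⟨2 * L + 3, q, _, ?_, hq⟩
  rw [show s + 2 * ρ * (L / (L + 1)) - (s + 2 * ρ) = -(2 * ρ / (L + 1) : ℝ) by field_simp; ring,
    abs_neg, abs_div, abs_mul, abs_two, abs_of_pos (show (0 : ℝ) < L + 1 by positivity),
    div_le_iff₀ (by positivity)]
  exact hL

end TestPoly

section Rounding

open Polynomial

variable {V : Type*} [Fintype V]

section RowSum

open scoped Matrix.Norms.Operator

theorem linftyOpNorm_le_of_row_sum_le (A : Matrix V V ℝ) {R : ℝ} (hR : 0 ≤ R)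
    (hA : ∀ v, ∑ u, |A v u| ≤ R) : ‖A‖ ≤ R := by
  lift R to NNReal using hR
  rw [Matrix.linfty_opNorm_def, NNReal.coe_le_coe]
  exact Finset.sup_le fun v _ => by simpa [← NNReal.coe_le_coe] using hA v

theorem abs_apply_le_linftyOpNorm (A : Matrix V V ℝ) (v w : V) : |A v w| ≤ ‖A‖ := by
  have hrow := Finset.le_sup (f := fun i => ∑ j, ‖A i j‖₊) (Finset.mem_univ v)
  rw [← NNReal.coe_le_coe, ← Matrix.linfty_opNorm_def] at hrow
  push_cast at hrow
  exact (Finset.single_le_sum (f := fun j => |A v j|) (fun _ _ => abs_nonneg _)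
    (Finset.mem_univ w)).trans hrow

variable [DecidableEq V]

theorem abs_aeval_apply_le (p : ℝ[X]) (A : Matrix V V ℝ) {R : ℝ} (hR : 0 ≤ R)
    (hA : ∀ v, ∑ u, |A v u| ≤ R) (v w : V) :
    |aeval A p v w| ≤ p.sum fun i a => |a| * R ^ i := by
  have : Nonempty V := ⟨v⟩
  refine (abs_apply_le_linftyOpNorm _ v w).trans ?_
  rw [aeval_def, eval₂_eq_sum, Polynomial.sum, Polynomial.sum]
  refine (norm_sum_le _ _).trans (Finset.sum_le_sum fun i _ => ?_)
  rw [← Algebra.smul_def, norm_smul, Real.norm_eq_abs]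
  gcongr
  exact (norm_pow_le A i).trans
    (pow_le_pow_left₀ (norm_nonneg _) (linftyOpNorm_le_of_row_sum_le A hR hA) i)

end RowSum

variable [DecidableEq V]

theorem isSymm_aeval {𝕜 : Type*} [CommSemiring 𝕜] {A : Matrix V V 𝕜} (hA : A.IsSymm)
    (p : 𝕜[X]) : (aeval A p).IsSymm := by
  rw [Matrix.IsSymm, aeval_eq_sum_range, Matrix.transpose_sum]
  exact Finset.sum_congr rfl fun i _ => by rw [Matrix.transpose_smul, (hA.pow i).eq]

/-- The diagonal entry at `v` of a polynomial in `A`: integration against the spectral measure of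
`A` at `v`. -/
noncomputable def diagFunctional (A : Matrix V V ℝ) (v : V) : ℝ[X] →ₗ[ℝ] ℝ :=
  (Matrix.entryLinearMap ℝ ℝ v v).comp (aeval A).toLinearMap

/-- The matrix obtained from `S` by making every index outside `s` isolated, with diagonal
entry `1`. -/
def isolateOutside (S : Matrix V V ℝ) (s : Finset V) : Matrix V V ℝ :=
  fun v w => if v ∈ s ∧ w ∈ s then S v w else (1 : Matrix V V ℝ) v w

theorem isSDPFeasible_isolateOutside {S : Matrix V V ℝ} (hS : S.PosSemidef) {s : Finset V}
    (hdiag : ∀ v ∈ s, S v v = 1) : IsSDPFeasible (isolateOutside S s) := by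
  refine ⟨?_, fun v => ?_⟩
  · let G : Matrix V V ℝ := Matrix.diagonal fun v => if v ∈ s then 1 else 0
    have hsum : isolateOutside S s =
        G.conjTranspose * S * G + Matrix.diagonal fun v => if v ∈ s then 0 else 1 := by
      ext v w
      rw [Matrix.add_apply, Matrix.mul_diagonal, Matrix.diagonal_conjTranspose,
        Matrix.diagonal_mul, Matrix.diagonal_apply, isolateOutside, Matrix.one_apply]
      by_cases hv : v ∈ s <;> by_cases hw : w ∈ s <;> by_cases hvw : v = w <;> simp_all
    rw [hsum]
    exact (hS.conjTranspose_mul_mul_same G).add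
      (.diagonal fun v => by dsimp only [Pi.zero_apply]; split_ifs <;> norm_num)
  · by_cases hv : v ∈ s
    · simp [isolateOutside, hv, hdiag]
    · simp [isolateOutside, hv]

theorem matInner_isolateOutside {A : Matrix V V ℝ} (hA : ∀ v, A v v = 0) (S : Matrix V V ℝ)
    (s : Finset V) :
    matInner A (isolateOutside S s) = ∑ v ∈ s, ∑ w ∈ s, A v w * S v w := by
  have hentry (v w : V) : A v w * isolateOutside S s v w =
      if v ∈ s then if w ∈ s then A v w * S v w else 0 else 0 := by
    by_cases hvw : v = w
    · simp [← hvw, hA]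
    · by_cases hv : v ∈ s <;> by_cases hw : w ∈ s <;> simp [isolateOutside, hv, hw, hvw]
  simp [matInner, hentry, Finset.sum_ite_irrel, Finset.sum_ite_mem]

theorem abs_matInner_isolateOutside_sub_le {A S : Matrix V V ℝ} (hA : A.IsSymm)
    (hdiag : ∀ v, A v v = 0) (hS : S.IsSymm) (s : Finset V) {τ R D : ℝ}
    (hτ : ∀ v ∈ s, (A * S) v v = τ) (hR : ∀ v, ∑ u, |A v u| ≤ R) (hD : ∀ v w, |S v w| ≤ D) :
    |matInner A (isolateOutside S s) - s.card * τ| ≤ sᶜ.card * (R * D) := by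
  have hfull : ∑ v ∈ s, ∑ w, A v w * S v w = s.card * τ := by
    rw [← nsmul_eq_mul, ← Finset.sum_const]
    refine Finset.sum_congr rfl fun v hv => ?_
    rw [← hτ v hv, Matrix.mul_apply]
    exact Finset.sum_congr rfl fun w _ => by rw [hS.apply]
  have hlost : matInner A (isolateOutside S s) - s.card * τ =
      -∑ w ∈ sᶜ, ∑ v ∈ s, A v w * S v w := by
    rw [matInner_isolateOutside hdiag, ← hfull, Finset.sum_comm (s := sᶜ),
      eq_neg_iff_add_eq_zero, sub_add_eq_add_sub, ← Finset.sum_add_distrib, sub_eq_zero]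
    exact Finset.sum_congr rfl fun v _ => Finset.sum_add_sum_compl s _
  rw [hlost, abs_neg]
  refine (Finset.abs_sum_le_sum_abs _ _).trans ?_
  rw [← nsmul_eq_mul]
  refine Finset.sum_le_card_nsmul _ _ _ fun w _ => ?_
  have hD0 : 0 ≤ D := (abs_nonneg _).trans (hD w w)
  calc |∑ v ∈ s, A v w * S v w| ≤ ∑ v ∈ s, |A v w * S v w| := Finset.abs_sum_le_sum_abs _ _
    _ ≤ ∑ v, |A v w * S v w| := Finset.sum_le_univ_sum_of_nonneg fun _ => abs_nonneg _
    _ ≤ ∑ v, |A w v| * D := by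
        refine Finset.sum_le_sum fun v _ => ?_
        rw [abs_mul, hA.apply]
        exact mul_le_mul_of_nonneg_left (hD v w) (abs_nonneg _)
    _ ≤ R * D := by
        rw [← Finset.sum_mul]
        exact mul_le_mul_of_nonneg_right (hR w) hD0

end Rounding

theorem exists_isSDPFeasible_of_diagFunctional (q : Polynomial ℝ) (τ : ℝ) {R : ℝ} (hR : 0 ≤ R) :
    ∃ D : ℝ, ∀ {V : Type*} [Fintype V] [DecidableEq V] (A : Matrix V V ℝ), A.IsSymm →
      (∀ v, A v v = 0) → (∀ v, ∑ u, |A v u| ≤ R) → ∀ s : Finset V,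
      (∀ v ∈ s, diagFunctional A v (q * q) = 1 ∧
        diagFunctional A v (Polynomial.X * (q * q)) = τ) →
      ∃ M : Matrix V V ℝ, IsSDPFeasible M ∧
        |matInner A M - Fintype.card V * τ| ≤ sᶜ.card * D := by
  refine ⟨R * ((q * q).sum fun i a => |a| * R ^ i) + |τ|, fun {V} _ _ A hA hdiag hrow s hs => ?_⟩
  have hq := isSymm_aeval hA q
  have hpos : (Polynomial.aeval A (q * q)).PosSemidef := by
    have := Matrix.posSemidef_conjTranspose_mul_self (Polynomial.aeval A q)
    rwa [Matrix.conjTranspose_eq_transpose_of_trivial, hq.eq, ← map_mul] at this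
  refine ⟨_, isSDPFeasible_isolateOutside hpos fun v hv => (hs v hv).1, ?_⟩
  have hloss := abs_matInner_isolateOutside_sub_le hA hdiag (isSymm_aeval hA (q * q)) s
    (fun v hv => by simpa [diagFunctional] using (hs v hv).2) hrow
    (abs_aeval_apply_le (q * q) A hR hrow)
  have hcard : (Fintype.card V : ℝ) = s.card + sᶜ.card := by
    exact_mod_cast (Finset.card_add_card_compl s).symm
  rw [hcard, add_mul, ← sub_sub, mul_add]
  refine (abs_sub _ _).trans (add_le_add hloss ?_)
  rw [abs_mul, Nat.abs_cast]

section Nonbacktracking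

open Polynomial Finset

variable {F R : Type*} [Fintype F] [DecidableEq F] [Ring R]

/-- The sum of the products `B f₀ * B f₁ * ⋯ * B fₖ` over the sequences with `f₀ = f` and
`fₜ ≠ fₜ₊₁` for all `t`. -/
def nonbacktrackingSum (B : F → R) : ℕ → F → R
  | 0, f => B f
  | k + 1, f => B f * ∑ g ∈ univ.erase f, nonbacktrackingSum B k g

theorem nonbacktrackingSum_succ (B : F → R) (k : ℕ) (f : F) : nonbacktrackingSum B (k + 1) f =
    B f * ((∑ g, nonbacktrackingSum B k g) - nonbacktrackingSum B k f) := by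
  rw [nonbacktrackingSum, ← add_sum_erase _ _ (mem_univ f), add_sub_cancel_left]

theorem mul_nonbacktrackingSum {B : F → R} {E : R} {f : F} (hE : E * B f = B f) (k : ℕ) :
    E * nonbacktrackingSum B k f = nonbacktrackingSum B k f := by
  cases k <;> simp only [nonbacktrackingSum, ← mul_assoc, hE]

variable {𝕜 : Type*} [CommRing 𝕜] [Algebra 𝕜 R] {B E : F → R} {s d c : 𝕜}

theorem sum_mul_sum_nonbacktrackingSum_zero (hB : ∀ f, B f * B f = s • B f + d • E f)
    (hsum : ∑ f, E f = c • 1) :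
    (∑ f, B f) * ∑ f, nonbacktrackingSum B 0 f =
      ∑ f, nonbacktrackingSum B 1 f + s • ∑ f, nonbacktrackingSum B 0 f
        + (d * c) • (1 : R) := by
  have hone (f : F) :
      nonbacktrackingSum B 1 f = B f * ∑ g, B g - (s • B f + d • E f) := by
    rw [nonbacktrackingSum_succ B 0, mul_sub, ← hB]
    rfl
  have hzero (f : F) : nonbacktrackingSum B 0 f = B f := rfl
  simp only [hone, hzero, sum_sub_distrib, ← sum_mul, sum_add_distrib, ← smul_sum, hsum]
  module

/-- In `B f₀ * (B f₁ * ⋯)` the terms with `f₀ = f₁` are simplified by the quadratic relation. -/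
theorem sum_mul_sum_nonbacktrackingSum_succ (hB : ∀ f, B f * B f = s • B f + d • E f)
    (hE : ∀ f, E f * B f = B f) (hsum : ∑ f, E f = c • 1) (k : ℕ) :
    (∑ f, B f) * ∑ f, nonbacktrackingSum B (k + 1) f =
      ∑ f, nonbacktrackingSum B (k + 2) f + s • ∑ f, nonbacktrackingSum B (k + 1) f
        + (d * (c - 1)) • ∑ f, nonbacktrackingSum B k f := by
  have hback (f : F) : B f * nonbacktrackingSum B (k + 1) f =
      s • nonbacktrackingSum B (k + 1) f
        + d • (E f * ∑ g, nonbacktrackingSum B k g - nonbacktrackingSum B k f) := by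
    rw [nonbacktrackingSum_succ, ← mul_assoc, hB, add_mul, smul_mul_assoc, smul_mul_assoc,
      mul_sub (E f), mul_nonbacktrackingSum (hE f)]
  simp only [nonbacktrackingSum_succ B (k + 1), mul_sub, hback, sum_sub_distrib, sum_add_distrib,
    ← sum_mul, ← smul_sum, hsum, smul_mul_assoc, one_mul]
  module

theorem aeval_jacobiPoly_eq_sum_nonbacktrackingSum (hB : ∀ f, B f * B f = s • B f + d • E f)
    (hE : ∀ f, E f * B f = B f) (hsum : ∑ f, E f = c • 1) (k : ℕ) :
    aeval (∑ f, B f) (jacobiPoly (rootThenBulk 0 s) (rootThenBulk (d * c) (d * (c - 1))) (k + 1)) =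
      ∑ f, nonbacktrackingSum B k f := by
  induction k using Nat.strong_induction_on with
  | _ k ih =>
    match k with
    | 0 => simp [jacobiPoly, nonbacktrackingSum, rootThenBulk]
    | 1 =>
      rw [jacobiPoly, map_sub, map_mul, ih 0 one_pos, map_sub, aeval_X, sub_mul,
        sum_mul_sum_nonbacktrackingSum_zero hB hsum]
      simp only [jacobiPoly, rootThenBulk_zero, rootThenBulk_succ, aeval_C, mul_one,
        Algebra.smul_def]
      abel
    | k + 2 =>
      rw [jacobiPoly, map_sub, map_mul, map_mul, ih (k + 1) (by omega), ih k (by omega), map_sub,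
        aeval_X, sub_mul, sum_mul_sum_nonbacktrackingSum_succ hB hE hsum]
      simp only [rootThenBulk_succ, aeval_C, Algebra.smul_def]
      abel

end Nonbacktracking

open Polynomial in
theorem mul_self_of_spectrum_eq_pair {V : Type*} [Fintype V] [DecidableEq V]
    {A : Matrix V V ℝ} (hA : A.IsSymm) {l₁ l₂ : ℝ} (h : spectrum ℝ A = {l₁, l₂}) :
    A * A = (l₁ + l₂) • A + (-(l₁ * l₂)) • (1 : Matrix V V ℝ) := by
  have hself : IsSelfAdjoint A := (Matrix.conjTranspose_eq_transpose_of_trivial A).trans hA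
  have hzero : aeval A ((X - C l₁) * (X - C l₂)) = 0 := by
    rw [← cfc_polynomial _ A hself, ← cfc_zero ℝ A]
    refine cfc_congr fun x hx => ?_
    rw [h] at hx
    rcases hx with rfl | rfl <;> simp
  rw [← sub_eq_zero, ← hzero]
  simp only [map_mul, map_sub, aeval_X, aeval_C, Algebra.algebraMap_eq_smul_one, sub_mul, mul_sub,
    smul_mul_assoc, mul_smul_comm, one_mul, mul_one]
  module

namespace Atom

variable {r : ℕ}

theorem mul_self_eq (A : Atom r) {l₁ l₂ : ℝ} (h : spectrum ℝ A.adj = {l₁, l₂}) :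
    A.adj * A.adj = (l₁ + l₂) • A.adj + (-(l₁ * l₂)) • 1 :=
  mul_self_of_spectrum_eq_pair A.symm h

theorem sum_sq_eq_neg_eigenvalue_mul (A : Atom r) {l₁ l₂ : ℝ} (h : spectrum ℝ A.adj = {l₁, l₂})
    (i : Fin r) : ∑ j, A.adj i j ^ 2 = -(l₁ * l₂) := by
  have hentry := congrFun₂ (A.mul_self_eq h) i i
  simp only [Matrix.mul_apply, A.symm.apply i, Matrix.add_apply, Matrix.smul_apply, A.loopless,
    Matrix.one_apply_eq, smul_eq_mul, mul_zero, mul_one, zero_add] at hentry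
  simpa only [sq] using hentry

theorem neg_eigenvalue_mul_pos (A : Atom r) {l₁ l₂ : ℝ} (hl : l₁ ≠ l₂)
    (h : spectrum ℝ A.adj = {l₁, l₂}) : 0 < -(l₁ * l₂) := by
  have hr : Nonempty (Fin r) := by
    by_contra hr
    rw [not_nonempty_iff] at hr
    exact (Set.insert_nonempty l₁ {l₂}).ne_empty (h ▸ spectrum.of_subsingleton A.adj)
  have hnonneg : 0 ≤ -(l₁ * l₂) := by
    rw [← A.sum_sq_eq_neg_eigenvalue_mul h hr.some]
    positivity
  refine hnonneg.lt_of_ne fun hzero => hl ?_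
  have hadj : A.adj = 0 := by
    ext i j
    have hrow := (A.sum_sq_eq_neg_eigenvalue_mul h i).trans hzero.symm
    rw [Finset.sum_eq_zero_iff_of_nonneg fun _ _ => sq_nonneg _] at hrow
    exact pow_eq_zero_iff two_ne_zero |>.1 (hrow j (Finset.mem_univ j))
  rw [hadj, spectrum.zero_eq] at h
  have h₁ : l₁ = 0 := by simpa using h.ge (Set.mem_insert l₁ {l₂})
  have h₂ : l₂ = 0 := by simpa using h.ge (Set.mem_insert_of_mem l₁ rfl)
  rw [h₁, h₂]

end Atom

theorem intCast_units_mul_self (x : ℤˣ) : ((x : ℤ) : ℝ) * ((x : ℤ) : ℝ) = 1 := by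
  rw [← Int.cast_mul, ← Units.val_mul, Int.units_mul_self, Units.val_one, Int.cast_one]

namespace ConstraintGraph

section Blocks

open Matrix

variable {r c n : ℕ} (K : ConstraintGraph r c n) (A : Fin c → Atom r)
  (ξ : ConVertex c n → Fin r → ℤˣ) (f : ConVertex c n)

/-- The embedding of `ℝ^r` into the functions on the variable vertices that sends the `i`-th basis
vector to `±` the neighbour of `f` in group `i`, with the sign `ξ f i`. -/
def signedEmbedding : Matrix (VarVertex r n) (Fin r) ℝ :=
  fun v i => if i = v.1 then if K.Incident v f then ((ξ f i : ℤ) : ℝ) else 0 else 0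

/-- The signed copy of an atom that the constraint vertex `f` places on its neighbours. -/
def block : Matrix (VarVertex r n) (VarVertex r n) ℝ :=
  K.signedEmbedding ξ f * (A f.1).adj * (K.signedEmbedding ξ f)ᵀ

theorem block_apply (v w : VarVertex r n) : K.block A ξ f v w =
    if K.Incident v f ∧ K.Incident w f then
      (((ξ f v.1 * ξ f w.1 : ℤˣ) : ℤ) : ℝ) * (A f.1).adj v.1 w.1
    else 0 := by
  simp only [block, mul_apply, transpose_apply, signedEmbedding, ite_mul, mul_ite, zero_mul,
    mul_zero, Finset.sum_ite_eq', Finset.mem_univ, if_true]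
  by_cases hv : K.Incident v f <;> by_cases hw : K.Incident w f <;> simp [hv, hw]
  ring

theorem instanceAdj_eq_sum_block : K.instanceAdj A ξ = ∑ f, K.block A ξ f := by
  ext v w
  simp only [Matrix.sum_apply, block_apply, instanceAdj]

theorem incident_iff_eq_symm_apply (v : VarVertex r n) :
    K.Incident v f ↔ v.2 = (K v.1 f.1).symm f.2 :=
  (Equiv.eq_symm_apply _).symm

theorem transpose_signedEmbedding_mul_self :
    (K.signedEmbedding ξ f)ᵀ * K.signedEmbedding ξ f = 1 := by
  ext i j
  rw [mul_apply, Fintype.sum_prod_type, Finset.sum_eq_single i]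
  · by_cases hij : i = j
    · subst hij
      simp [signedEmbedding, incident_iff_eq_symm_apply, intCast_units_mul_self]
    · simp [signedEmbedding, hij, Ne.symm hij]
  · intro k _ hk
    simp [signedEmbedding, Ne.symm hk]
  · simp

variable {K f} in
theorem Incident.eq_iff {v w : VarVertex r n} (hv : K.Incident v f) :
    v = w ↔ v.1 = w.1 ∧ K.Incident w f := by
  refine ⟨fun h => ⟨congrArg Prod.fst h, h ▸ hv⟩, fun ⟨h, hw⟩ => Prod.ext h ?_⟩
  exact (K v.1 f.1).injective (Eq.trans hv (by rw [h]; exact Eq.symm hw))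

theorem sum_ite_incident {M : Type*} [AddCommMonoid M] (v : VarVertex r n)
    (g : ConVertex c n → M) :
    ∑ f, (if K.Incident v f then g f else 0) = ∑ j, g (j, K v.1 j v.2) := by
  rw [Fintype.sum_prod_type]
  refine Finset.sum_congr rfl fun j _ => ?_
  rw [Finset.sum_eq_single (K v.1 j v.2)]
  · exact if_pos rfl
  · exact fun b _ hb => if_neg fun h => hb (Eq.symm h)
  · simp

theorem sum_signedEmbedding_mul_transpose :
    ∑ f, K.signedEmbedding ξ f * (K.signedEmbedding ξ f)ᵀ = (c : ℝ) • 1 := by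
  ext v w
  have hentry (f : ConVertex c n) : (K.signedEmbedding ξ f * (K.signedEmbedding ξ f)ᵀ) v w =
      if K.Incident v f then if v = w then 1 else 0 else 0 := by
    rw [mul_apply, Finset.sum_eq_single v.1]
    · by_cases hv : K.Incident v f
      · by_cases hvw : v = w
        · simp [← hvw, signedEmbedding, hv, intCast_units_mul_self]
        · have hw : v.1 = w.1 → ¬ K.Incident w f := fun h hw => hvw (hv.eq_iff.2 ⟨h, hw⟩)
          simp [signedEmbedding, hvw, ← ite_and, not_and.2 hw]
      · simp [signedEmbedding, hv]
    · intro i _ hi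
      simp [signedEmbedding, hi]
    · simp
  simp only [Matrix.sum_apply, hentry, sum_ite_incident]
  simp [one_apply]

theorem signedEmbedding_mul_transpose_mul_block :
    K.signedEmbedding ξ f * (K.signedEmbedding ξ f)ᵀ * K.block A ξ f = K.block A ξ f := by
  rw [block]
  simp only [Matrix.mul_assoc]
  rw [← Matrix.mul_assoc _ (K.signedEmbedding ξ f) (_ * _), transpose_signedEmbedding_mul_self,
    Matrix.one_mul]

theorem block_mul_self {l₁ l₂ : ℝ} (hA : spectrum ℝ (A f.1).adj = {l₁, l₂}) :
    K.block A ξ f * K.block A ξ f = (l₁ + l₂) • K.block A ξ f +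
      (-(l₁ * l₂)) • (K.signedEmbedding ξ f * (K.signedEmbedding ξ f)ᵀ) := by
  have hW := K.transpose_signedEmbedding_mul_self ξ f
  have hsq : K.block A ξ f * K.block A ξ f =
      K.signedEmbedding ξ f * ((A f.1).adj * (A f.1).adj) * (K.signedEmbedding ξ f)ᵀ := by
    simp only [block, Matrix.mul_assoc]
    rw [← Matrix.mul_assoc (K.signedEmbedding ξ f)ᵀ, hW, Matrix.one_mul]
  rw [hsq, (A f.1).mul_self_eq hA, block, Matrix.mul_add, Matrix.add_mul, Matrix.mul_smul,
    Matrix.smul_mul, Matrix.mul_smul, Matrix.smul_mul, Matrix.mul_one]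

theorem instanceAdj_isSymm : (K.instanceAdj A ξ).IsSymm := by
  refine Matrix.IsSymm.ext fun v w => Finset.sum_congr rfl fun f _ => ?_
  rw [(A f.1).symm.apply, mul_comm (ξ f w.1)]
  exact if_congr and_comm rfl rfl

theorem instanceAdj_self (v : VarVertex r n) : K.instanceAdj A ξ v v = 0 :=
  Finset.sum_eq_zero fun f _ => by simp [(A f.1).loopless]

theorem sum_ite_incident_and (v : VarVertex r n) :
    ∑ w, ∑ f, (if K.Incident v f ∧ K.Incident w f then (1 : ℝ) else 0) = c * r := by
  have hneighbours (f : ConVertex c n) : ∑ w, (if K.Incident w f then (1 : ℝ) else 0) = r := by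
    rw [Fintype.sum_prod_type]
    simp [incident_iff_eq_symm_apply]
  have hswap (f : ConVertex c n) :
      ∑ w, (if K.Incident v f ∧ K.Incident w f then (1 : ℝ) else 0) =
        if K.Incident v f then (r : ℝ) else 0 := by
    split_ifs with hv <;> simp [hv, ← hneighbours f]
  rw [Finset.sum_comm, Finset.sum_congr rfl fun f _ => hswap f,
    K.sum_ite_incident v fun _ => (r : ℝ)]
  simp

theorem sum_abs_instanceAdj_le (v : VarVertex r n) : ∑ w, |K.instanceAdj A ξ v w| ≤ c * r := by
  rw [← K.sum_ite_incident_and v]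
  gcongr with w
  refine (Finset.abs_sum_le_sum_abs _ _).trans ?_
  gcongr with f
  split_ifs
  · rcases Int.units_eq_one_or (ξ f v.1 * ξ f w.1) with hx | hx <;>
      rcases (A f.1).weight v.1 w.1 with ha | ha | ha <;> simp [hx, ha]
  · exact abs_zero.le

end Blocks

end ConstraintGraph

section RandomPermutations

open Finset

variable {E α : Type*}

/-- The permutation that a letter of a word in the free group on `E` stands for. -/
def letterPerm (σ : E → Equiv.Perm α) (x : E × Bool) : Equiv.Perm α :=
  bif x.2 then σ x.1 else (σ x.1)⁻¹

/-- The end of the walk from `a` along the word `L`. As in a product of permutations, the last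
letter acts first, so that the points visited on the way are the ends of the suffixes of `L`. -/
def walkEnd (σ : E → Equiv.Perm α) (a : α) (L : List (E × Bool)) : α :=
  FreeGroup.lift σ (FreeGroup.mk L) a

theorem walkEnd_nil (σ : E → Equiv.Perm α) (a : α) : walkEnd σ a [] = a := by
  rw [walkEnd, FreeGroup.lift_mk, List.map_nil, List.prod_nil, Equiv.Perm.one_apply]

theorem walkEnd_cons (σ : E → Equiv.Perm α) (a : α) (x : E × Bool) (L : List (E × Bool)) :
    walkEnd σ a (x :: L) = letterPerm σ x (walkEnd σ a L) := by
  rw [walkEnd, walkEnd, FreeGroup.lift_mk, FreeGroup.lift_mk, List.map_cons, List.prod_cons,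
    Equiv.Perm.mul_apply, letterPerm]

theorem letterPerm_inv (σ : E → Equiv.Perm α) (x : E × Bool) :
    letterPerm σ (x.1, !x.2) = (letterPerm σ x)⁻¹ := by
  obtain ⟨e, b⟩ := x
  cases b <;> simp [letterPerm]

theorem injOn_walkEnd_cons {σ : E → Equiv.Perm α} {a : α} {x : E × Bool} {L : List (E × Bool)}
    (hinj : Set.InjOn (walkEnd σ a) {S | S <:+ L})
    (hnew : ∀ S, S <:+ L → walkEnd σ a (x :: L) ≠ walkEnd σ a S) :
    Set.InjOn (walkEnd σ a) {S | S <:+ x :: L} := by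
  have hmem : x :: L ∉ {S | S <:+ L} := fun h => by simpa using h.length_le
  have hsuffix : {S | S <:+ x :: L} = insert (x :: L) {S | S <:+ L} :=
    Set.ext fun S => List.suffix_cons_iff
  rw [hsuffix, Set.injOn_insert hmem]
  exact ⟨hinj, fun ⟨S, hS, hSx⟩ => hnew S hS hSx.symm⟩

variable [DecidableEq E]

/-- The family `σ`, changed at the generator of the letter `x` so that the permutation of `x` is
followed by `τ`. -/
def switchLetter (σ : E → Equiv.Perm α) (x : E × Bool) (τ : Equiv.Perm α) : E → Equiv.Perm α :=
  Function.update σ x.1 (bif x.2 then τ * σ x.1 else σ x.1 * τ⁻¹)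

theorem letterPerm_switchLetter_self (σ : E → Equiv.Perm α) (x : E × Bool) (τ : Equiv.Perm α) :
    letterPerm (switchLetter σ x τ) x = τ * letterPerm σ x := by
  obtain ⟨e, b⟩ := x
  cases b <;> simp [letterPerm, switchLetter]

theorem letterPerm_switchLetter_inv (σ : E → Equiv.Perm α) (x : E × Bool) (τ : Equiv.Perm α) :
    letterPerm (switchLetter σ x τ) (x.1, !x.2) = (letterPerm σ x)⁻¹ * τ⁻¹ := by
  rw [letterPerm_inv, letterPerm_switchLetter_self, mul_inv_rev]

theorem letterPerm_switchLetter_of_ne (σ : E → Equiv.Perm α) {x y : E × Bool} (h : y.1 ≠ x.1)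
    (τ : Equiv.Perm α) : letterPerm (switchLetter σ x τ) y = letterPerm σ y := by
  simp [letterPerm, switchLetter, h]

theorem switchLetter_switchLetter_inv (σ : E → Equiv.Perm α) (x : E × Bool) (τ : Equiv.Perm α) :
    switchLetter (switchLetter σ x τ) x τ⁻¹ = σ := by
  obtain ⟨e, b⟩ := x
  cases b <;> simp [switchLetter]

theorem finite_freeGroup_norm_le [Finite E] (m : ℕ) : {g : FreeGroup E | g.norm ≤ m}.Finite :=
  (List.finite_length_le (E × Bool) m).preimage FreeGroup.toWord_injective.injOn

variable [DecidableEq α]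

/-- Redirecting the last step of a walk that has no self-intersection before that step to a point
`y` not visited so far leaves all the earlier steps alone: those that use the same generator neither
arrive at the old end point nor at `y`. -/
theorem walkEnd_switchLetter_of_isSuffix {σ : E → Equiv.Perm α} {a y : α} {x : E × Bool}
    {L S : List (E × Bool)} (hL : FreeGroup.IsReduced (x :: L))
    (hinj : Set.InjOn (walkEnd σ a) {S | S <:+ L}) (hy : ∀ S, S <:+ L → walkEnd σ a S ≠ y)
    (hS : S <:+ L) :
    walkEnd (switchLetter σ x (Equiv.swap (walkEnd σ a (x :: L)) y)) a S = walkEnd σ a S := by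
  induction S with
  | nil => rw [walkEnd_nil, walkEnd_nil]
  | cons z S ih =>
    have hS' : S <:+ L := (List.suffix_cons z S).trans hS
    rw [walkEnd_cons, ih hS']
    by_cases hgen : z.1 = x.1
    · by_cases hsign : z.2 = x.2
      · obtain rfl : z = x := Prod.ext hgen hsign
        have hend : walkEnd σ a (z :: S) ≠ walkEnd σ a (z :: L) := fun h => by
          rw [walkEnd_cons, walkEnd_cons, (letterPerm σ z).apply_eq_iff_eq] at h
          obtain rfl := hinj hS' List.suffix_rfl h
          simpa using hS.length_le
        rw [letterPerm_switchLetter_self, Equiv.Perm.mul_apply, ← walkEnd_cons,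
          Equiv.swap_apply_of_ne_of_ne hend (hy _ hS)]
      · obtain rfl : z = (x.1, !x.2) := Prod.ext hgen (Bool.eq_not_of_ne hsign)
        have hstart : walkEnd σ a S ≠ walkEnd σ a (x :: L) := fun h => by
          have hback : walkEnd σ a ((x.1, !x.2) :: S) = walkEnd σ a L := by
            rw [walkEnd_cons, h, letterPerm_inv, walkEnd_cons, Equiv.Perm.inv_def,
              Equiv.symm_apply_apply]
          obtain rfl := hinj hS List.suffix_rfl hback
          simpa using (FreeGroup.isReduced_cons_cons.1 hL).1 rfl
        rw [letterPerm_switchLetter_inv, Equiv.Perm.mul_apply, Equiv.swap_inv,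
          Equiv.swap_apply_of_ne_of_ne hstart (hy S hS'), walkEnd_cons, letterPerm_inv]
    · rw [letterPerm_switchLetter_of_ne σ hgen, walkEnd_cons]

theorem walkEnd_cons_switchLetter {σ : E → Equiv.Perm α} {a y : α} {x : E × Bool}
    {L : List (E × Bool)} (hL : FreeGroup.IsReduced (x :: L))
    (hinj : Set.InjOn (walkEnd σ a) {S | S <:+ L}) (hy : ∀ S, S <:+ L → walkEnd σ a S ≠ y) :
    walkEnd (switchLetter σ x (Equiv.swap (walkEnd σ a (x :: L)) y)) a (x :: L) = y := by
  rw [walkEnd_cons (switchLetter _ _ _),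
    walkEnd_switchLetter_of_isSuffix hL hinj hy List.suffix_rfl, letterPerm_switchLetter_self,
    Equiv.Perm.mul_apply, ← walkEnd_cons, Equiv.swap_apply_left]

variable [Fintype E] [Fintype α]

open Classical in
/-- Redirecting the closing step to the `card α - (L.length + 1)` unvisited points is injective. -/
theorem card_walkEnd_cons_eq_mul_le (a : α) {x : E × Bool} {L S : List (E × Bool)}
    (hL : FreeGroup.IsReduced (x :: L)) (hS : S <:+ L) :
    #{σ : E → Equiv.Perm α | Set.InjOn (walkEnd σ a) {S | S <:+ L} ∧
      walkEnd σ a (x :: L) = walkEnd σ a S} * (Fintype.card α - (L.length + 1)) ≤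
      Fintype.card (E → Equiv.Perm α) := by
  set closing : Finset (E → Equiv.Perm α) := {σ | Set.InjOn (walkEnd σ a) {S | S <:+ L} ∧
    walkEnd σ a (x :: L) = walkEnd σ a S}
  set unvisited : (E → Equiv.Perm α) → Finset α := fun σ =>
    (L.tails.map (walkEnd σ a)).toFinsetᶜ with hunvisited
  have hcard (σ : E → Equiv.Perm α) : Fintype.card α - (L.length + 1) ≤ #(unvisited σ) := by
    rw [hunvisited, card_compl]
    refine Nat.sub_le_sub_left ((List.toFinset_card_le _).trans_eq ?_) _
    rw [List.length_map, List.length_tails]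
  have hswitch {p : (_ : E → Equiv.Perm α) × α} (hp : p ∈ closing.sigma unvisited) :
      walkEnd (switchLetter p.1 x (Equiv.swap (walkEnd p.1 a S) p.2)) a S = walkEnd p.1 a S ∧
      walkEnd (switchLetter p.1 x (Equiv.swap (walkEnd p.1 a S) p.2)) a (x :: L) = p.2 := by
    obtain ⟨hp₁, hp₂⟩ := mem_sigma.1 hp
    obtain ⟨-, hinj, hclose⟩ := mem_filter.1 hp₁
    have hy (S) (hS : S <:+ L) : walkEnd p.1 a S ≠ p.2 := fun h =>
      mem_compl.1 hp₂ (List.mem_toFinset.2 (List.mem_map.2 ⟨S, (List.mem_tails _ _).2 hS, h⟩))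
    rw [← hclose]
    exact ⟨(walkEnd_switchLetter_of_isSuffix hL hinj hy hS).trans hclose.symm,
      walkEnd_cons_switchLetter hL hinj hy⟩
  calc #closing * (Fintype.card α - (L.length + 1)) ≤ ∑ σ ∈ closing, #(unvisited σ) :=
        card_nsmul_le_sum _ _ _ fun σ _ => hcard σ
    _ = #(closing.sigma unvisited) := (card_sigma _ _).symm
    _ ≤ #(univ : Finset (E → Equiv.Perm α)) := by
        refine card_le_card_of_injOn
          (fun p => switchLetter p.1 x (Equiv.swap (walkEnd p.1 a S) p.2)) (by simp) ?_
        intro p hp q hq (hpq : switchLetter _ _ _ = switchLetter _ _ _)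
        obtain ⟨hpS, hp₂⟩ := hswitch hp
        obtain ⟨hqS, hq₂⟩ := hswitch hq
        have hsnd : p.2 = q.2 := by rw [← hp₂, hpq, hq₂]
        have hbase : walkEnd p.1 a S = walkEnd q.1 a S := by rw [← hpS, hpq, hqS]
        rw [hsnd, hbase] at hpq
        have hfst : p.1 = q.1 := by
          rw [← switchLetter_switchLetter_inv p.1, hpq, switchLetter_switchLetter_inv]
        exact Sigma.ext hfst (heq_of_eq hsnd)
    _ = Fintype.card (E → Equiv.Perm α) := card_univ

open Classical in
theorem card_not_injOn_walkEnd_mul_le (a : α) {L : List (E × Bool)}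
    (hL : FreeGroup.IsReduced L) :
    #{σ : E → Equiv.Perm α | ¬ Set.InjOn (walkEnd σ a) {S | S <:+ L}} *
      (Fintype.card α - L.length) ≤ L.length ^ 2 * Fintype.card (E → Equiv.Perm α) := by
  induction L with
  | nil => simp [Set.injOn_singleton]
  | cons x L ih =>
    set closing : List (E × Bool) → Finset (E → Equiv.Perm α) := fun S =>
      {σ | Set.InjOn (walkEnd σ a) {S | S <:+ L} ∧ walkEnd σ a (x :: L) = walkEnd σ a S}
    set bad : List (E × Bool) → Finset (E → Equiv.Perm α) := fun S =>
      {σ | ¬ Set.InjOn (walkEnd σ a) {T | T <:+ S}}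
    have hcover : bad (x :: L) ⊆ bad L ∪ L.tails.toFinset.biUnion closing := by
      intro σ hσ
      by_contra hσ'
      simp only [bad, closing, mem_union, mem_filter_univ, not_or, not_not, mem_biUnion,
        List.mem_toFinset, List.mem_tails, not_exists, not_and] at hσ hσ'
      exact hσ (injOn_walkEnd_cons hσ'.1 fun S hS => hσ'.2 S hS hσ'.1)
    have hclosing (S) (hS : S ∈ L.tails.toFinset) :
        #(closing S) * (Fintype.card α - (L.length + 1)) ≤ Fintype.card (E → Equiv.Perm α) :=
      card_walkEnd_cons_eq_mul_le a hL ((List.mem_tails _ _).1 (List.mem_toFinset.1 hS))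
    have htails : #L.tails.toFinset ≤ L.length + 1 :=
      (List.toFinset_card_le _).trans_eq (List.length_tails _)
    have hrest := (Nat.mul_le_mul_left _ (Nat.sub_le_sub_left L.length.le_succ _)).trans
      (ih (hL.infix (List.suffix_cons x L).isInfix))
    have hunion := (card_le_card hcover).trans
      ((card_union_le _ _).trans (Nat.add_le_add_left card_biUnion_le _))
    calc _ ≤ _ := Nat.mul_le_mul_right _ hunion
      _ ≤ L.length ^ 2 * Fintype.card (E → Equiv.Perm α) +
          (L.length + 1) * Fintype.card (E → Equiv.Perm α) := by
          rw [add_mul, sum_mul]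
          exact Nat.add_le_add hrest
            ((sum_le_card_nsmul _ _ _ hclosing).trans (Nat.mul_le_mul_right _ htails))
      _ ≤ _ := by
          rw [← add_mul, List.length_cons]
          exact Nat.mul_le_mul_right _ (by nlinarith)

open Classical in
theorem card_lift_apply_eq_self_mul_le (a : α) {g : FreeGroup E} (hg : g ≠ 1) :
    #{σ : E → Equiv.Perm α | FreeGroup.lift σ g a = a} * (Fintype.card α - g.norm) ≤
      g.norm ^ 2 * Fintype.card (E → Equiv.Perm α) := by
  refine le_trans (Nat.mul_le_mul_right _ (card_le_card ?_))
    (card_not_injOn_walkEnd_mul_le a FreeGroup.isReduced_toWord)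
  intro σ hσ
  rw [mem_filter_univ] at hσ ⊢
  intro hinj
  have hclosed : walkEnd σ a g.toWord = walkEnd σ a [] := by
    rw [walkEnd_nil, walkEnd, FreeGroup.mk_toWord, hσ]
  exact hg (FreeGroup.toWord_eq_nil_iff.1 (hinj List.suffix_rfl List.nil_suffix hclosed))

open Classical in
theorem exists_card_lift_apply_eq_self_mul_le (E : Type*) [Fintype E] [DecidableEq E] (m : ℕ) :
    ∃ C : ℕ, ∀ {α : Type*} [Fintype α] [DecidableEq α] (a : α),
      #{σ : E → Equiv.Perm α | ∃ g : FreeGroup E, g ≠ 1 ∧ g.norm ≤ m ∧ FreeGroup.lift σ g a = a} *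
        (Fintype.card α - m) ≤ C * Fintype.card (E → Equiv.Perm α) := by
  refine ⟨#(finite_freeGroup_norm_le (E := E) m).toFinset * m ^ 2, fun {α} _ _ a => ?_⟩
  set ball := {g ∈ (finite_freeGroup_norm_le (E := E) m).toFinset | g ≠ 1}
  have hcover : ({σ | ∃ g : FreeGroup E, g ≠ 1 ∧ g.norm ≤ m ∧ FreeGroup.lift σ g a = a} :
      Finset (E → Equiv.Perm α)) ⊆ ball.biUnion fun g => {σ | FreeGroup.lift σ g a = a} := by
    intro σ hσ
    obtain ⟨g, hg, hgm, hσg⟩ := (mem_filter_univ _).1 hσ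
    exact mem_biUnion.2 ⟨g, by simpa [ball] using ⟨hgm, hg⟩, (mem_filter_univ _).2 hσg⟩
  have hword (g) (hg : g ∈ ball) : #{σ : E → Equiv.Perm α | FreeGroup.lift σ g a = a} *
      (Fintype.card α - m) ≤ m ^ 2 * Fintype.card (E → Equiv.Perm α) := by
    obtain ⟨hgm, hg⟩ : g.norm ≤ m ∧ g ≠ 1 := by simpa [ball] using hg
    exact (Nat.mul_le_mul_left _ (Nat.sub_le_sub_left hgm _)).trans
      ((card_lift_apply_eq_self_mul_le a hg).trans (by gcongr))
  calc _ ≤ (∑ g ∈ ball, #{σ : E → Equiv.Perm α | FreeGroup.lift σ g a = a}) *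
        (Fintype.card α - m) := Nat.mul_le_mul_right _ ((card_le_card hcover).trans card_biUnion_le)
    _ ≤ #ball * (m ^ 2 * Fintype.card (E → Equiv.Perm α)) := by
        rw [sum_mul]
        exact sum_le_card_nsmul _ _ _ hword
    _ ≤ _ := by
        rw [mul_assoc]
        exact Nat.mul_le_mul_right _ (card_filter_le _ _)

end RandomPermutations

namespace ConstraintGraph

section ShortCycles

open Finset

variable {r c n : ℕ} (K : ConstraintGraph r c n)

/-- The permutations of a lift of `K_{r,c}`, as one family indexed by the edges. -/
def edgePerm : ConstraintGraph r c n ≃ (Fin r × Fin c → Equiv.Perm (Fin n)) :=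
  (Equiv.curry _ _ _).symm

/-- The walk along some nontrivial reduced word of length at most `m` in the permutations of the
lift returns to `v`. Every vertex on a closed walk of length at most `m` without backtracking in the
constraint graph has this property; here the words need not correspond to walks. -/
def IsCyclic (m : ℕ) (v : VarVertex r n) : Prop :=
  ∃ g : FreeGroup (Fin r × Fin c), g ≠ 1 ∧ g.norm ≤ m ∧ FreeGroup.lift (edgePerm K) g v.2 = v.2

theorem IsCyclic.mono {K : ConstraintGraph r c n} {m m' : ℕ} {v : VarVertex r n}
    (h : K.IsCyclic m v) (hm : m ≤ m') : K.IsCyclic m' v :=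
  let ⟨g, hg, hgm, hgv⟩ := h
  ⟨g, hg, hgm.trans hm, hgv⟩

variable {K} in
theorem walkEnd_cons_cons_of_incident {v u : VarVertex r n} {f : ConVertex c n}
    (hv : K.Incident v f) (hu : K.Incident u f) {a : Fin n} {L : List ((Fin r × Fin c) × Bool)}
    (hL : walkEnd (edgePerm K) a L = u.2) :
    walkEnd (edgePerm K) a (((v.1, f.1), false) :: ((u.1, f.1), true) :: L) = v.2 := by
  rw [walkEnd_cons, walkEnd_cons, hL]
  exact Equiv.Perm.inv_eq_iff_eq.2 (Eq.trans hu hv.symm)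

variable {K} in
theorem of_block_apply_ne_zero {A : Fin c → Atom r} {ξ : ConVertex c n → Fin r → ℤˣ}
    {f : ConVertex c n} {v u : VarVertex r n} (h : K.block A ξ f v u ≠ 0) :
    K.Incident v f ∧ K.Incident u f ∧ v.1 ≠ u.1 := by
  rw [block_apply] at h
  obtain ⟨⟨hv, hu⟩, hne⟩ := ite_ne_right_iff.1 h
  refine ⟨hv, hu, fun heq => hne ?_⟩
  rw [heq, (A f.1).loopless, mul_zero]

theorem exists_isReduced_of_nonbacktrackingSum_block_ne_zero {A : Fin c → Atom r}
    {ξ : ConVertex c n → Fin r → ℤˣ} {w : VarVertex r n} {k : ℕ} {f : ConVertex c n}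
    {v : VarVertex r n} (h : nonbacktrackingSum (K.block A ξ) k f v w ≠ 0) :
    K.Incident v f ∧ ∃ L, FreeGroup.IsReduced (((v.1, f.1), false) :: L) ∧
      L.length = 2 * k + 1 ∧ walkEnd (edgePerm K) w.2 (((v.1, f.1), false) :: L) = v.2 := by
  induction k generalizing f v with
  | zero =>
    obtain ⟨hv, hw, hvw⟩ := of_block_apply_ne_zero h
    refine ⟨hv, [((w.1, f.1), true)], ?_, rfl,
      walkEnd_cons_cons_of_incident hv hw (walkEnd_nil _ _)⟩
    simp [FreeGroup.isReduced_cons_cons, hvw]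
  | succ k ih =>
    rw [nonbacktrackingSum, Matrix.mul_apply] at h
    obtain ⟨u, -, hu⟩ := exists_ne_zero_of_sum_ne_zero h
    obtain ⟨hv, huf, hvu⟩ := of_block_apply_ne_zero (left_ne_zero_of_mul hu)
    have hrest := right_ne_zero_of_mul hu
    rw [Matrix.sum_apply] at hrest
    obtain ⟨g, hg, hgu⟩ := exists_ne_zero_of_sum_ne_zero hrest
    obtain ⟨hug, L, hred, hlen, hend⟩ := ih hgu
    have hfg : f.1 ≠ g.1 := fun hfst => ne_of_mem_erase hg <| Prod.ext hfst.symm <|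
      hug.symm.trans (Eq.trans (by rw [hfst]) huf)
    refine ⟨hv, ((u.1, f.1), true) :: ((u.1, g.1), false) :: L, ?_, by
      simp only [List.length_cons, hlen]; ring, walkEnd_cons_cons_of_incident hv huf hend⟩
    rw [FreeGroup.isReduced_cons_cons, FreeGroup.isReduced_cons_cons]
    simp [hvu, hfg, hred]

theorem nonbacktrackingSum_block_self_eq_zero (A : Fin c → Atom r)
    (ξ : ConVertex c n → Fin r → ℤˣ) {k : ℕ} {v : VarVertex r n}
    (hv : ¬ K.IsCyclic (2 * (k + 1)) v) (f : ConVertex c n) :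
    nonbacktrackingSum (K.block A ξ) k f v v = 0 := by
  by_contra h
  obtain ⟨-, L, hred, hlen, hend⟩ := K.exists_isReduced_of_nonbacktrackingSum_block_ne_zero h
  have hword := FreeGroup.toWord_mk.trans hred.reduce_eq
  refine hv ⟨FreeGroup.mk (((v.1, f.1), false) :: L), fun hone => ?_, ?_, hend⟩
  · simp [hone] at hword
  · simp only [FreeGroup.norm, hword, List.length_cons, hlen]
    omega

/-- Around a vertex that lies on no short cycle the instance graph looks like the additive product
of the atoms, whose spectral measure is known. -/
theorem isJacobiFunctional_diagFunctional (A : Fin c → Atom r) {l₁ l₂ : ℝ}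
    (hA : ∀ j, spectrum ℝ (A j).adj = {l₁, l₂}) (ξ : ConVertex c n → Fin r → ℤˣ) {N : ℕ}
    {v : VarVertex r n} (hv : ¬ K.IsCyclic (2 * N) v) :
    IsJacobiFunctional (rootThenBulk 0 (l₁ + l₂))
      (rootThenBulk (-(l₁ * l₂) * c) (-(l₁ * l₂) * (c - 1))) N
      (diagFunctional (K.instanceAdj A ξ) v) := by
  intro k hk
  cases k with
  | zero => simp [jacobiPoly, diagFunctional]
  | succ k =>
    have hentry : diagFunctional (K.instanceAdj A ξ) v
        (jacobiPoly (rootThenBulk 0 (l₁ + l₂))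
          (rootThenBulk (-(l₁ * l₂) * c) (-(l₁ * l₂) * (c - 1))) (k + 1)) =
        (∑ f, nonbacktrackingSum (K.block A ξ) k f) v v := by
      rw [← aeval_jacobiPoly_eq_sum_nonbacktrackingSum
        (fun f => K.block_mul_self A ξ f (hA f.1))
        (K.signedEmbedding_mul_transpose_mul_block A ξ)
        (K.sum_signedEmbedding_mul_transpose ξ), ← instanceAdj_eq_sum_block]
      rfl
    rw [hentry, Matrix.sum_apply, if_neg k.succ_ne_zero]
    refine sum_eq_zero fun f _ => K.nonbacktrackingSum_block_self_eq_zero A ξ (fun hk' => hv ?_) f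
    exact hk'.mono (by omega)

end ShortCycles

end ConstraintGraph

section Markov

variable {Ω ι : Type*} [MeasurableSpace Ω] [Fintype ι]

open Classical in
theorem measure_card_lt_mul_card_le (μ : Measure Ω) {s : ι → Set Ω} {p : ENNReal}
    (hs : ∀ i, MeasurableSet (s i)) (hp : ∀ i, μ (s i) ≤ p) (T : ℕ) :
    μ {ω | Fintype.card ι < T * (Finset.univ.filter fun i => ω ∈ s i).card} ≤ T * p := by
  rcases isEmpty_or_nonempty ι with hι | hι
  · simp
  have hcount (ω : Ω) : ((Finset.univ.filter fun i => ω ∈ s i).card : ENNReal) =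
      ∑ i, (s i).indicator 1 ω := by
    simp [Set.indicator_apply]
  have hmeas : Measurable fun ω => (T : ENNReal) * ∑ i, (s i).indicator 1 ω :=
    (Finset.measurable_fun_sum _ fun i _ => measurable_one.indicator (hs i)).const_mul _
  have hmarkov : (Fintype.card ι : ENNReal) *
      μ {ω | (Fintype.card ι : ENNReal) ≤ T * ∑ i, (s i).indicator 1 ω} ≤
        Fintype.card ι * (T * p) := calc
    _ ≤ ∫⁻ ω, T * ∑ i, (s i).indicator 1 ω ∂μ := mul_meas_ge_le_lintegral hmeas _
    _ = T * ∑ i, μ (s i) := by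
      rw [lintegral_const_mul' _ _ (ENNReal.natCast_ne_top T),
        lintegral_finsetSum _ fun i _ => measurable_one.indicator (hs i)]
      simp only [lintegral_indicator_one (hs _)]
    _ ≤ T * (Fintype.card ι * p) := by
      gcongr
      exact (Finset.sum_le_card_nsmul _ _ p fun i _ => hp i).trans_eq (nsmul_eq_mul _ _)
    _ = _ := mul_left_comm _ _ _
  refine (measure_mono fun ω hω => ?_).trans
    ((ENNReal.mul_le_mul_iff_right (by simp) (ENNReal.natCast_ne_top _)).1 hmarkov)
  rw [Set.mem_ofPred_eq] at hω ⊢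
  rw [← hcount]
  exact_mod_cast hω.le

end Markov

namespace ConstraintGraph

section FewShortCycles

open Finset Filter

variable {r c n : ℕ}

instance : MeasurableSingletonClass (ConstraintGraph r c n) := ⟨fun _ => trivial⟩

instance : Nonempty (ConstraintGraph r c n) := ⟨fun _ _ => 1⟩

theorem exists_uniformOn_isCyclic_le (r c m : ℕ) : ∃ C : ℕ, ∀ {n : ℕ}, m < n →
    ∀ v : VarVertex r n,
      uniformOn Set.univ {K : ConstraintGraph r c n | K.IsCyclic m v} ≤ C * (↑(n - m))⁻¹ := by
  classical
  obtain ⟨C, hC⟩ := exists_card_lift_apply_eq_self_mul_le (Fin r × Fin c) m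
  refine ⟨C, fun {n} hn v => ?_⟩
  have hcard : #{K : ConstraintGraph r c n | K.IsCyclic m v} * (n - m) ≤
      C * Fintype.card (ConstraintGraph r c n) := by
    have hv := hC v.2
    rw [← Fintype.card_congr edgePerm, Fintype.card_fin] at hv
    refine (Nat.mul_le_mul_right _ ?_).trans hv
    exact card_le_card_of_injOn edgePerm (fun K hK => mem_coe.2 <| (mem_filter_univ _).2 <|
      (mem_filter_univ K).1 (mem_coe.1 hK)) edgePerm.injective.injOn
  rw [uniformOn_univ, ← coe_filter_univ, Measure.count_apply_finset]
  refine ENNReal.div_le_of_le_mul ?_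
  rw [mul_right_comm, ← div_eq_mul_inv, ENNReal.le_div_iff_mul_le
    (.inl (Nat.cast_ne_zero.2 (Nat.sub_ne_zero_of_lt hn))) (.inl (ENNReal.natCast_ne_top _))]
  exact_mod_cast hcard

open Classical in
theorem tendsto_uniformOn_card_lt_mul_isCyclic (r c m T : ℕ) :
    Tendsto (fun n => uniformOn Set.univ {K : ConstraintGraph r c n |
      Fintype.card (VarVertex r n) < T * #{v | K.IsCyclic m v}}) atTop (nhds 0) := by
  obtain ⟨C, hC⟩ := exists_uniformOn_isCyclic_le r c m
  have hlim : Tendsto (fun n => T * (C * (↑(n - m) : ENNReal)⁻¹)) atTop (nhds 0) := by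
    have hinv := ENNReal.tendsto_inv_nat_nhds_zero.comp (tendsto_sub_atTop_nat m)
    have hC := ENNReal.Tendsto.const_mul hinv (.inr (ENNReal.natCast_ne_top C))
    simpa using ENNReal.Tendsto.const_mul hC (.inr (ENNReal.natCast_ne_top T))
  refine tendsto_of_tendsto_of_tendsto_of_le_of_le' tendsto_const_nhds hlim
    (.of_forall fun _ => zero_le) ?_
  filter_upwards [eventually_gt_atTop m] with n hn
  exact measure_card_lt_mul_card_le _ (fun _ => MeasurableSpace.measurableSet_top) (hC hn) T

end FewShortCycles

section Value

open Finset

variable {r c : ℕ}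

open Classical in
theorem exists_isSDPFeasible_of_card_isCyclic_le (hc : 1 ≤ c) (A : Fin c → Atom r) {l₁ l₂ : ℝ}
    (hl : l₁ ≠ l₂) (hA : ∀ j, spectrum ℝ (A j).adj = {l₁, l₂}) {ρ ε : ℝ}
    (hρ : ρ ^ 2 = (c - 1) * (-(l₁ * l₂))) (hε : 0 < ε) :
    ∃ m T : ℕ, ∀ {n : ℕ} (K : ConstraintGraph r c n) (ξ : ConVertex c n → Fin r → ℤˣ),
      T * #{v | K.IsCyclic m v} ≤ Fintype.card (VarVertex r n) →
      ∃ M, IsSDPFeasible M ∧ |matInner (K.instanceAdj A ξ) M -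
        (l₁ + l₂ + 2 * ρ) * Fintype.card (VarVertex r n)| ≤ ε * Fintype.card (VarVertex r n) := by
  have hb : 0 < -(l₁ * l₂) * c :=
    mul_pos ((A ⟨0, hc⟩).neg_eigenvalue_mul_pos hl (hA _)) (by exact_mod_cast hc)
  obtain ⟨N, q, τ, hτ, hq⟩ := exists_testPoly (l₁ + l₂) ρ hb (half_pos hε)
  obtain ⟨D, hD⟩ := exists_isSDPFeasible_of_diagFunctional q τ (show 0 ≤ (c : ℝ) * r by positivity)
  obtain ⟨T, hT⟩ := exists_nat_ge (2 * D / ε)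
  refine ⟨2 * N, T, fun {n} K ξ hfew => ?_⟩
  set cyclic : Finset (VarVertex r n) := {v | K.IsCyclic (2 * N) v}
  obtain ⟨M, hM, hval⟩ := hD (K.instanceAdj A ξ) (K.instanceAdj_isSymm A ξ)
    (K.instanceAdj_self A ξ) (K.sum_abs_instanceAdj_le A ξ) cyclicᶜ fun v hv => hq _ <| by
      rw [hρ, mul_comm _ (-(l₁ * l₂))]
      exact K.isJacobiFunctional_diagFunctional A hA ξ (by simpa [cyclic] using hv)
  refine ⟨M, hM, ?_⟩
  rw [compl_compl] at hval
  have hfew' : (T : ℝ) * #cyclic ≤ Fintype.card (VarVertex r n) := by exact_mod_cast hfew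
  set V : ℝ := (Fintype.card (VarVertex r n) : ℝ)
  have hloss : #cyclic * D ≤ ε / 2 * V := by
    rw [div_le_iff₀ hε] at hT
    nlinarith
  have hshift : |V * τ - (l₁ + l₂ + 2 * ρ) * V| ≤ ε / 2 * V := by
    rw [mul_comm V, ← sub_mul, abs_mul, abs_of_nonneg (show 0 ≤ V by positivity)]
    gcongr
  linarith [abs_sub_le (matInner (K.instanceAdj A ξ) M) (V * τ) ((l₁ + l₂ + 2 * ρ) * V)]

theorem tendsto_uniformOn_not_exists_isSDPFeasible (hc : 1 ≤ c) (A : Fin c → Atom r) {l₁ l₂ : ℝ}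
    (hl : l₁ ≠ l₂) (hA : ∀ j, spectrum ℝ (A j).adj = {l₁, l₂}) {ρ ε : ℝ}
    (hρ : ρ ^ 2 = (c - 1) * (-(l₁ * l₂))) (hε : 0 < ε) :
    Filter.Tendsto (fun n => uniformOn Set.univ {K : ConstraintGraph r c n |
      ¬ ∀ ξ, ∃ M, IsSDPFeasible M ∧ |matInner (K.instanceAdj A ξ) M -
        (l₁ + l₂ + 2 * ρ) * Fintype.card (VarVertex r n)| ≤ ε * Fintype.card (VarVertex r n)})
      Filter.atTop (nhds 0) := by
  obtain ⟨m, T, h⟩ := exists_isSDPFeasible_of_card_isCyclic_le hc A hl hA hρ hε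
  refine tendsto_of_tendsto_of_tendsto_of_le_of_le tendsto_const_nhds
    (tendsto_uniformOn_card_lt_mul_isCyclic r c m T) (fun _ => zero_le) fun n => ?_
  exact measure_mono fun K hK => not_le.1 fun hfew => hK fun ξ => h K ξ hfew

end Value

end ConstraintGraph

theorem IsRandomNegatedLift.uniformOn_le {Ω : Type*} [MeasurableSpace Ω] {μ : Measure Ω}
    {r c n : ℕ} {K : Ω → ConstraintGraph r c n} {ξ : Ω → ConVertex c n → Fin r → ℤˣ}
    (h : IsRandomNegatedLift μ K ξ)
    (P : ConstraintGraph r c n → (ConVertex c n → Fin r → ℤˣ) → Prop) :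
    uniformOn Set.univ {κ | ∀ x, P κ x} ≤ μ {ω | P (K ω) (ξ ω)} := by
  rw [← h.lift_uniform, Measure.map_apply h.measurable_lift trivial]
  exact measure_mono fun ω hω => hω (ξ ω)

theorem mainTheorem8_general {r c : ℕ} (hc : 1 ≤ c) (A : Fin c → Atom r) (l₁ l₂ : ℝ)
    (hl : l₁ ≠ l₂) (hA : ∀ j, spectrum ℝ (A j).adj = {l₁, l₂}) (ε : ℝ) (hε : 0 < ε) :
    Filter.Tendsto
      (fun n => uniformOn Set.univ {K : ConstraintGraph r c n |
        ∀ ξ, ∃ Mp Mm : Matrix (VarVertex r n) (VarVertex r n) ℝ,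
          IsSDPFeasible Mp ∧ IsSDPFeasible Mm ∧
          (l₁ + l₂ + 2 * √(((c : ℝ) - 1) * (-(l₁ * l₂))) - ε) *
            (Fintype.card (VarVertex r n) : ℝ) ≤ matInner (K.instanceAdj A ξ) Mp ∧
          matInner (K.instanceAdj A ξ) Mm ≤
            (l₁ + l₂ - 2 * √(((c : ℝ) - 1) * (-(l₁ * l₂))) + ε) *
              (Fintype.card (VarVertex r n) : ℝ)})
      Filter.atTop (nhds 1) := by
  have hd := (A ⟨0, hc⟩).neg_eigenvalue_mul_pos hl (hA _)
  have hρ := Real.sq_sqrt (mul_nonneg (sub_nonneg.2 (Nat.one_le_cast.2 hc)) hd.le)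
  have hp := ConstraintGraph.tendsto_uniformOn_not_exists_isSDPFeasible hc A hl hA hρ hε
  have hm := ConstraintGraph.tendsto_uniformOn_not_exists_isSDPFeasible hc A hl hA
    ((neg_sq _).trans hρ) hε
  have hgood := ENNReal.Tendsto.sub tendsto_const_nhds (hp.add hm) (.inl ENNReal.one_ne_top)
  rw [add_zero, tsub_zero] at hgood
  refine tendsto_of_tendsto_of_tendsto_of_le_of_le hgood tendsto_const_nhds (fun n => ?_)
    fun _ => prob_le_one
  rw [tsub_le_iff_right, ← measure_univ (μ := uniformOn (Set.univ : Set (ConstraintGraph r c n)))]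
  refine (measure_mono fun K _ => ?_).trans
    ((measure_union_le _ _).trans (add_le_add_right (measure_union_le _ _) _))
  by_contra hK
  simp only [Set.mem_union, Set.mem_ofPred_eq, not_or, not_not] at hK
  refine hK.1 fun ξ => ?_
  obtain ⟨Mp, hMp, hvalp⟩ := hK.2.1 ξ
  obtain ⟨Mm, hMm, hvalm⟩ := hK.2.2 ξ
  exact ⟨Mp, Mm, hMp, hMm, by linarith [(abs_le.1 hvalp).1], by linarith [(abs_le.1 hvalm).2]⟩

theorem mainTheorem8 {r c : ℕ} (hc : 1 ≤ c) (A : Fin c → Atom r) (l₁ l₂ : ℝ) (hl : l₁ ≠ l₂)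
    (hA : ∀ j, spectrum ℝ (A j).adj = {l₁, l₂})
    (Ω : ℕ → Type*) [∀ n, MeasurableSpace (Ω n)]
    (μ : ∀ n, MeasureTheory.Measure (Ω n)) [∀ n, MeasureTheory.IsProbabilityMeasure (μ n)]
    (K : ∀ n, Ω n → ConstraintGraph r c n) (ξ : ∀ n, Ω n → ConVertex c n → Fin r → ℤˣ)
    (hK : ∀ n, IsRandomNegatedLift (μ n) (K n) (ξ n))
    (ε : ℝ) (hε : 0 < ε) :
    Filter.Tendsto
      (fun n => μ n {ω | ∃ Mp Mm : Matrix (VarVertex r n) (VarVertex r n) ℝ,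
        IsSDPFeasible Mp ∧ IsSDPFeasible Mm ∧
        (l₁ + l₂ + 2 * √(((c : ℝ) - 1) * (-(l₁ * l₂))) - ε) * (Fintype.card (VarVertex r n) : ℝ)
          ≤ matInner ((K n ω).instanceAdj A (ξ n ω)) Mp ∧
        matInner ((K n ω).instanceAdj A (ξ n ω)) Mm
          ≤ (l₁ + l₂ - 2 * √(((c : ℝ) - 1) * (-(l₁ * l₂))) + ε)
            * (Fintype.card (VarVertex r n) : ℝ)})
      Filter.atTop (nhds 1) :=
  tendsto_of_tendsto_of_tendsto_of_le_of_le (mainTheorem8_general hc A l₁ l₂ hl hA ε hε)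
    tendsto_const_nhds (fun n => (hK n).uniformOn_le _) fun _ => prob_le_one
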